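/- Let $T$ be the right shift on $\ell^2(\mathbb{Z}_+)$, $Te_n=e_{n+1}$, and let the Toeplitz algebra $\mathcal{T}$ be the norm closed subalgebra of $\mathcal{B}(\ell^2(\mathbb{Z}_+))$ generated by $T$ and $T^*$. Let $\mathcal{T}\otimes\mathcal{T}$ be the minimal $C^*$-tensor product, and let $\Delta\colon\mathcal{T}\to\mathcal{T}\otimes\mathcal{T}$ be the unique unital $*$-homomorphism with $\Delta(T)=T\otimes T$. Let $\mathcal{T}^*$ be the Banach space of all continuous linear functionals on $\mathcal{T}$, with the dual norm $\|\rho\|=\sup_{\|A\|\le 1}|\rho(A)|$. For $\rho,\varphi\in\mathcal{T}^*$ let $\rho\otimes\varphi$ be the unique continuous linear functional on $\mathcal{T}\otimes\mathcal{T}$ with $(\rho\otimes\varphi)(A\otimes B)=\rho(A)\varphi(B)$ for all $A,B\in\mathcal{T}$, and define $\rho\ast\varphi\in\mathcal{T}^*$ by $$(\rho\ast\varphi)(A)=(\rho\otimes\varphi)(\Delta(A)),\qquad A\in\mathcal{T}.$$ Then $\mathcal{T}^*$ with the product $\ast$ is a commutative Banach algebra: it is complete, the product is bilinear, associative and commutative,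 and $\|\rho\ast\varphi\|\le\|\rho\|\,\|\varphi\|$ for all $\rho,\varphi\in\mathcal{T}^*$. -/

import Mathlib

open scoped TensorProduct

noncomputable section

namespace Toeplitz

/-- The Hilbert space of square summable complex sequences indexed by the natural numbers. -/
abbrev L2 : Type := lp (fun _ : ℕ => ℂ) 2

/-- The standard orthonormal basis vector with index `n`. -/
def e (n : ℕ) : L2 := lp.single 2 n 1

/-- The sequence `0, f 0, f 1, …`. -/
def shiftSeq (f : ℕ → ℂ) : ℕ → ℂ
  | 0 => 0
  | n + 1 => f n

theorem memℓp_shiftSeq (f : L2) : Memℓp (shiftSeq f) 2 := by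
  refine memℓp_gen ?_
  rw [← summable_nat_add_iff 1]
  exact (lp.memℓp f).summable (by norm_num)

/-- The right shift as a linear map. -/
def shiftLinear : L2 →ₗ[ℂ] L2 where
  toFun f := ⟨shiftSeq f, memℓp_shiftSeq f⟩
  map_add' f g := by
    refine lp.ext (funext fun n => ?_)
    cases n
    · exact (add_zero (0 : ℂ)).symm
    · rfl
  map_smul' c f := by
    refine lp.ext (funext fun n => ?_)
    cases n
    · exact (mul_zero c).symm
    · rfl

theorem inner_shiftLinear (f g : L2) : inner ℂ (shiftLinear f) (shiftLinear g) = inner ℂ f g := by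
  have hs := lp.summable_inner (𝕜 := ℂ) (shiftLinear f) (shiftLinear g)
  have h0 : (shiftLinear f : ℕ → ℂ) 0 = 0 := rfl
  have h1 := hs.tsum_eq_zero_add
  rw [h0, inner_zero_left, zero_add] at h1
  rw [lp.inner_eq_tsum, lp.inner_eq_tsum]
  exact h1

/-- The right shift operator `T` on `ℓ²`. -/
def shift : L2 →L[ℂ] L2 := (shiftLinear.isometryOfInner inner_shiftLinear).toContinuousLinearMap

theorem shift_e (n : ℕ) : shift (e n) = e (n + 1) := by
  refine lp.ext (funext fun m => ?_)
  cases m with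
  | zero =>
    have : (shift (e n) : ℕ → ℂ) 0 = 0 := rfl
    rw [this]
    simp [e]
  | succ m =>
    have : (shift (e n) : ℕ → ℂ) (m + 1) = (e n : ℕ → ℂ) m := rfl
    rw [this]
    simp [e, Pi.single_apply]

/-- The Toeplitz algebra: the norm closed subalgebra of the bounded operators on `ℓ²`
generated by `T` and `T*`. -/
def toeplitz : StarSubalgebra ℂ (L2 →L[ℂ] L2) := StarAlgebra.elemental ℂ shift

theorem isClosed_toeplitz : IsClosed (toeplitz : Set (L2 →L[ℂ] L2)) :=
  StarAlgebra.elemental.isClosed ℂ shift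

/-- The Toeplitz algebra as a type, with the C*-algebra structure (in particular the operator norm)
inherited from the bounded operators on `ℓ²`. -/
def Toep : Type := toeplitz

/-- The C*-algebra structure of a closed star subalgebra. -/
def Toep.cstarAlgebra : CStarAlgebra Toep :=
  StarSubalgebra.cstarAlgebra toeplitz (h_closed := isClosed_toeplitz)

instance : CStarAlgebra Toep := Toep.cstarAlgebra

/-- The inclusion of the Toeplitz algebra in the bounded operators on `ℓ²`. -/
def Toep.val : Toep →⋆ₐ[ℂ] (L2 →L[ℂ] L2) := toeplitz.subtype

theorem Toep.val_mem (A : Toep) : A.val ∈ toeplitz := Subtype.property (p := (· ∈ toeplitz)) A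

theorem Toep.norm_val (A : Toep) : ‖A.val‖ = ‖A‖ := rfl

/-- The shift as an element of the Toeplitz algebra. -/
def T : Toep := (⟨shift, StarAlgebra.elemental.self_mem ℂ shift⟩ : toeplitz)

/-- The Hilbert space tensor product of `ℓ²` with itself. -/
def L2L2 : Type := UniformSpace.Completion (L2 ⊗[ℂ] L2)

instance : NormedAddCommGroup L2L2 :=
  inferInstanceAs (NormedAddCommGroup (UniformSpace.Completion (L2 ⊗[ℂ] L2)))

instance : InnerProductSpace ℂ L2L2 :=
  inferInstanceAs (InnerProductSpace ℂ (UniformSpace.Completion (L2 ⊗[ℂ] L2)))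

instance : CompleteSpace L2L2 :=
  inferInstanceAs (CompleteSpace (UniformSpace.Completion (L2 ⊗[ℂ] L2)))

/-- The inclusion of the algebraic tensor product. -/
def ofAlg : L2 ⊗[ℂ] L2 →L[ℂ] L2L2 :=
  (UniformSpace.Completion.toComplL : L2 ⊗[ℂ] L2 →L[ℂ] UniformSpace.Completion (L2 ⊗[ℂ] L2))

/-- The bounded operator `A ⊗ B` on the Hilbert space tensor product. -/
def opTensor (A B : L2 →L[ℂ] L2) : L2L2 →L[ℂ] L2L2 := (TensorProduct.mapL A B).completion

/-- The minimal (spatial) C*-tensor product of the Toeplitz algebra with itself: the norm closed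
star subalgebra of the bounded operators on the Hilbert space tensor product that is generated by
the operators `A ⊗ B` with `A` and `B` in the Toeplitz algebra. -/
def minTensor : StarSubalgebra ℂ (L2L2 →L[ℂ] L2L2) :=
  (StarAlgebra.adjoin ℂ {X | ∃ A ∈ toeplitz, ∃ B ∈ toeplitz, X = opTensor A B}).topologicalClosure

theorem isClosed_minTensor : IsClosed (minTensor : Set (L2L2 →L[ℂ] L2L2)) :=
  StarSubalgebra.isClosed_topologicalClosure _

/-- The minimal tensor product as a type, with the C*-algebra structure inherited from the bounded
operators on the Hilbert space tensor product. -/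
def MinTensor : Type := minTensor

/-- The C*-algebra structure of a closed star subalgebra. -/
def MinTensor.cstarAlgebra : CStarAlgebra MinTensor :=
  StarSubalgebra.cstarAlgebra minTensor (h_closed := isClosed_minTensor)

instance : CStarAlgebra MinTensor := MinTensor.cstarAlgebra

/-- The inclusion of the minimal tensor product in the bounded operators. -/
def MinTensor.val : MinTensor →⋆ₐ[ℂ] (L2L2 →L[ℂ] L2L2) := minTensor.subtype

theorem MinTensor.norm_val (X : MinTensor) : ‖X.val‖ = ‖X‖ := rfl

theorem MinTensor.val_ext {X Y : MinTensor} (h : X.val = Y.val) : X = Y :=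
  Subtype.ext (p := (· ∈ minTensor)) h

/-- The elementary tensor `A ⊗ B` as an element of the minimal tensor product. -/
def tmul (A B : Toep) : MinTensor :=
  (⟨opTensor A.val B.val, StarSubalgebra.le_topologicalClosure _
    (StarAlgebra.subset_adjoin ℂ _ ⟨A.val, A.val_mem, B.val, B.val_mem, rfl⟩)⟩ : minTensor)

theorem val_tmul (A B : Toep) : (tmul A B).val = opTensor A.val B.val := rfl

/-! ### Auxiliary facts on the Hilbert space tensor product -/

/-- The vector `x ⊗ y`. -/
def vec (x y : L2) : L2L2 := ofAlg (x ⊗ₜ[ℂ] y)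

/-- The map `x ↦ x ⊗ y`. -/
def vecL (y : L2) : L2 →L[ℂ] L2L2 :=
  ofAlg ∘L (TensorProduct.mkL ℂ L2 L2).flip y

/-- The map `y ↦ x ⊗ y`. -/
def vecR (x : L2) : L2 →L[ℂ] L2L2 :=
  ofAlg ∘L (TensorProduct.mkL ℂ L2 L2) x

theorem vecL_apply (x y : L2) : vecL y x = vec x y := rfl

theorem vecR_apply (x y : L2) : vecR x y = vec x y := rfl

theorem inner_vec (a b c d : L2) :
    inner ℂ (vec a b) (vec c d) = inner ℂ a c * inner ℂ b d := by
  rw [← TensorProduct.inner_tmul]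
  exact UniformSpace.Completion.inner_coe (𝕜 := ℂ) _ _

theorem norm_vecL_le (y : L2) : ‖vecL y‖ ≤ ‖y‖ := by
  refine ContinuousLinearMap.opNorm_le_bound _ (norm_nonneg _) fun x => ?_
  rw [mul_comm, ← TensorProduct.norm_tmul (𝕜 := ℂ) x y]
  exact (UniformSpace.Completion.norm_coe (x ⊗ₜ[ℂ] y)).le

theorem opTensor_vec (A B : L2 →L[ℂ] L2) (x y : L2) :
    opTensor A B (vec x y) = vec (A x) (B y) := by
  exact ContinuousLinearMap.completion_apply_coe (TensorProduct.mapL A B) (x ⊗ₜ[ℂ] y)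

theorem ext_vec {E : Type*} [NormedAddCommGroup E] [NormedSpace ℂ E] {f g : L2L2 →L[ℂ] E}
    (h : ∀ x y, f (vec x y) = g (vec x y)) : f = g := by
  refine ContinuousLinearMap.ext fun z => ?_
  induction z using UniformSpace.Completion.induction_on with
  | hp => exact isClosed_eq f.continuous g.continuous
  | ih z =>
    change f (ofAlg z) = g (ofAlg z)
    induction z using TensorProduct.induction_on with
    | zero => simp only [map_zero]
    | tmul x y => exact h x y
    | add a b ha hb => simp only [map_add, ha, hb]

theorem inner_e (m : ℕ) (f : L2) : inner ℂ (e m) f = f m := by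
  rw [e, lp.inner_single_left]
  simp

theorem ext_e {E : Type*} [NormedAddCommGroup E] [NormedSpace ℂ E] {f g : L2 →L[ℂ] E}
    (h : ∀ n, f (e n) = g (e n)) : f = g := by
  refine lp.ext_continuousLinearMap (by simp) fun n => ?_
  ext
  exact h n

theorem eq_zero_of_inner {z : L2L2} (h : ∀ i j, inner ℂ z (vec (e i) (e j)) = 0) : z = 0 := by
  have h1 : ∀ i y, inner ℂ z (vec (e i) y) = 0 := fun i y =>
    DFunLike.congr_fun (ext_e (f := innerSL ℂ z ∘L vecR (e i)) (g := 0) (h i)) y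
  have h2 : ∀ x y, inner ℂ z (vec x y) = 0 := fun x y =>
    DFunLike.congr_fun (ext_e (f := innerSL ℂ z ∘L vecL y) (g := 0) (fun i => h1 i y)) x
  have h3 := ext_vec (f := innerSL ℂ z) (g := 0) h2
  exact inner_self_eq_zero (𝕜 := ℂ).1 (DFunLike.congr_fun h3 z)

theorem orthonormal_e : Orthonormal ℂ e := by
  classical
  rw [orthonormal_iff_ite]
  intro i j
  rw [inner_e]
  simp [e, Pi.single_apply]

theorem orthonormal_vec : Orthonormal ℂ (fun p : ℕ × ℕ => vec (e p.1) (e p.2)) := by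
  classical
  have h := orthonormal_iff_ite.1 orthonormal_e
  rw [orthonormal_iff_ite]
  rintro ⟨i, j⟩ ⟨k, l⟩
  simp only [inner_vec, h, Prod.mk.injEq]
  by_cases hik : i = k <;> by_cases hjl : j = l <;> simp [hik, hjl]

theorem opTensor_mul (A B C D : L2 →L[ℂ] L2) :
    opTensor (A * C) (B * D) = opTensor A B * opTensor C D :=
  ext_vec fun x y => by
    simp only [mul_apply_eq_comp, opTensor_vec]

theorem opTensor_one : opTensor 1 1 = 1 :=
  ext_vec fun x y => by
    simp only [one_apply_eq_self, opTensor_vec]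

theorem opTensor_star (A B : L2 →L[ℂ] L2) :
    star (opTensor A B) = opTensor (star A) (star B) := by
  refine ext_vec fun x y => ?_
  refine ext_inner_left ℂ fun z => ?_
  rw [ContinuousLinearMap.star_eq_adjoint, ContinuousLinearMap.adjoint_inner_right]
  have key : (innerSL ℂ (vec x y)) ∘L opTensor A B =
      innerSL ℂ (opTensor (star A) (star B) (vec x y)) := by
    refine ext_vec fun a b => ?_
    simp only [ContinuousLinearMap.comp_apply, innerSL_apply_apply, opTensor_vec, inner_vec,
      ContinuousLinearMap.star_eq_adjoint, ContinuousLinearMap.adjoint_inner_left]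
  have := DFunLike.congr_fun key z
  simp only [ContinuousLinearMap.comp_apply, innerSL_apply_apply] at this
  rw [← inner_conj_symm, this, inner_conj_symm]

theorem opTensor_add_left (A A' B : L2 →L[ℂ] L2) :
    opTensor (A + A') B = opTensor A B + opTensor A' B :=
  ext_vec fun x y => by
    simp only [add_apply, opTensor_vec]
    exact map_add (vecL _) _ _

theorem opTensor_add_right (A B B' : L2 →L[ℂ] L2) :
    opTensor A (B + B') = opTensor A B + opTensor A B' :=
  ext_vec fun x y => by
    simp only [add_apply, opTensor_vec]
    exact map_add (vecR _) _ _

theorem opTensor_smul_left (c : ℂ) (A B : L2 →L[ℂ] L2) :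
    opTensor (c • A) B = c • opTensor A B :=
  ext_vec fun x y => by
    simp only [smul_apply, opTensor_vec]
    exact map_smul (vecL _) _ _

theorem opTensor_smul_right (c : ℂ) (A B : L2 →L[ℂ] L2) :
    opTensor A (c • B) = c • opTensor A B :=
  ext_vec fun x y => by
    simp only [smul_apply, opTensor_vec]
    exact map_smul (vecR _) _ _

/-! ### Existence and uniqueness of the comultiplication -/

/-- The star homomorphism `A ↦ A ⊗ 1`. -/
def ampliation : (L2 →L[ℂ] L2) →⋆ₐ[ℂ] (L2L2 →L[ℂ] L2L2) where
  toFun A := opTensor A 1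
  map_one' := opTensor_one
  map_mul' A B := by rw [← opTensor_mul, one_mul]
  map_zero' := by simpa using opTensor_smul_left 0 0 1
  map_add' A B := opTensor_add_left A B 1
  commutes' c := by
    rw [Algebra.algebraMap_eq_smul_one, Algebra.algebraMap_eq_smul_one, opTensor_smul_left,
      opTensor_one]
  map_star' A := by rw [opTensor_star, star_one]

/-- The bijection of pairs that keeps the minimum and encodes the difference. -/
def sigma (p : ℕ × ℕ) : ℕ × ℕ :=
  (min p.1 p.2, if p.2 ≤ p.1 then 2 * (p.1 - p.2) else 2 * (p.2 - p.1) - 1)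

theorem sigma_injective : Function.Injective sigma := by
  rintro ⟨a, b⟩ ⟨c, d⟩ h
  simp only [sigma, Prod.mk.injEq] at h ⊢
  split_ifs at h <;> omega

theorem sigma_surjective : Function.Surjective sigma := by
  rintro ⟨m, k⟩
  rcases Nat.even_or_odd' k with ⟨r, rfl | rfl⟩
  · refine ⟨(m + r, m), ?_⟩
    simp [sigma]
  · refine ⟨(m, m + r + 1), ?_⟩
    simp only [sigma, Prod.mk.injEq]
    split_ifs <;> omega

theorem sigma_succ (i j : ℕ) : sigma (i + 1, j + 1) = ((sigma (i, j)).1 + 1, (sigma (i, j)).2) := by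
  simp only [sigma, Prod.mk.injEq]
  split_ifs <;> omega

theorem exists_unitary : ∃ J : L2L2 ≃ₗᵢ[ℂ] L2L2, ∀ i j,
    J (vec (e i) (e j)) = vec (e (sigma (i, j)).1) (e (sigma (i, j)).2) := by
  classical
  have hs := sigma_surjective
  let b : HilbertBasis (ℕ × ℕ) ℂ L2L2 := HilbertBasis.mkOfOrthogonalEqBot orthonormal_vec (by
    rw [Submodule.eq_bot_iff]
    intro z hz
    exact eq_zero_of_inner fun i j =>
      (Submodule.mem_orthogonal' _ _).1 hz _ (Submodule.subset_span ⟨(i, j), rfl⟩))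
  let b' : HilbertBasis (ℕ × ℕ) ℂ L2L2 := HilbertBasis.mkOfOrthogonalEqBot
    (orthonormal_vec.comp sigma sigma_injective) (by
      rw [Submodule.eq_bot_iff]
      intro z hz
      refine eq_zero_of_inner fun i j => ?_
      obtain ⟨q, hq⟩ := hs (i, j)
      refine (Submodule.mem_orthogonal' _ _).1 hz _ (Submodule.subset_span ⟨q, ?_⟩)
      simp [hq])
  refine ⟨b.repr.trans b'.repr.symm, fun i j => ?_⟩
  have hb : b (i, j) = vec (e i) (e j) := by
    simp only [b, HilbertBasis.coe_mkOfOrthogonalEqBot]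
  have hb' : b' (i, j) = vec (e (sigma (i, j)).1) (e (sigma (i, j)).2) := by
    simp only [b', HilbertBasis.coe_mkOfOrthogonalEqBot, Function.comp]
  rw [← hb, ← hb', LinearIsometryEquiv.trans_apply, HilbertBasis.repr_self,
    HilbertBasis.repr_symm_single]

theorem continuous_starAlgHom (Δ : Toep →⋆ₐ[ℂ] MinTensor) : Continuous Δ := by
  refine AddMonoidHomClass.continuous_of_bound Δ 1 fun x => ?_
  rw [one_mul]
  exact NonUnitalStarAlgHom.norm_apply_le Δ x

/-- There is exactly one unital star homomorphism from the Toeplitz algebra to the minimal tensor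
product that maps `T` to `T ⊗ T`. -/
theorem existsUnique_comul : ∃! Δ : Toep →⋆ₐ[ℂ] MinTensor, Δ T = tmul T T := by
  obtain ⟨J, hJ⟩ := exists_unitary
  let Φ : (L2 →L[ℂ] L2) →⋆ₐ[ℂ] (L2L2 →L[ℂ] L2L2) :=
    (StarAlgEquiv.toStarAlgHom J.symm.conjStarAlgEquiv).comp ampliation
  have hΦ : Φ shift = opTensor shift shift := by
    refine ext_vec fun x y => ?_
    have h1 : ∀ i j, Φ shift (vec (e i) (e j)) = opTensor shift shift (vec (e i) (e j)) := by
      intro i j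
      change J.symm (opTensor shift 1 (J.symm.symm (vec (e i) (e j)))) = _
      rw [LinearIsometryEquiv.symm_symm, LinearIsometryEquiv.symm_apply_eq, hJ, opTensor_vec,
        opTensor_vec, shift_e, shift_e, shift_e, hJ, sigma_succ]
      rfl
    have h2 : ∀ i y, Φ shift (vec (e i) y) = opTensor shift shift (vec (e i) y) := fun i y =>
      DFunLike.congr_fun (ext_e (f := Φ shift ∘L vecR (e i))
        (g := opTensor shift shift ∘L vecR (e i)) (h1 i)) y
    exact DFunLike.congr_fun (ext_e (f := Φ shift ∘L vecL y)
      (g := opTensor shift shift ∘L vecL y) (fun i => h2 i y)) x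
  have hc : Continuous Φ := map_continuous Φ
  have hle : toeplitz ≤ minTensor.comap Φ := by
    refine StarAlgebra.elemental.le_of_mem (isClosed_minTensor.preimage hc) ?_
    change Φ shift ∈ minTensor
    rw [hΦ]
    exact (tmul T T).2
  refine ⟨(Φ.comp toeplitz.subtype).codRestrict minTensor fun A => hle A.2,
    Subtype.ext hΦ, fun Ψ hΨ => ?_⟩
  refine StarAlgebra.elemental.starAlgHomClass_ext ℂ (continuous_starAlgHom Ψ)
    (continuous_starAlgHom _) ?_
  exact hΨ.trans (Subtype.ext hΦ.symm)

/-- The comultiplication of the Toeplitz algebra: the unique unital star homomorphism `Δ` from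
the Toeplitz algebra to its minimal tensor square with `Δ T = T ⊗ T`. -/
def comul : Toep →⋆ₐ[ℂ] MinTensor := Classical.choose existsUnique_comul

theorem comul_T : comul T = tmul T T := (Classical.choose_spec existsUnique_comul).1

theorem continuous_comul : Continuous comul := continuous_starAlgHom comul

/-! ### Existence and uniqueness of the tensor product of functionals -/

/-- The canonical linear map from the algebraic to the minimal tensor product. -/
def ofAlgTensor : Toep ⊗[ℂ] Toep →ₗ[ℂ] MinTensor :=
  TensorProduct.lift (LinearMap.mk₂ ℂ tmul
    (fun A A' B => MinTensor.val_ext (opTensor_add_left A.val A'.val B.val))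
    (fun c A B => MinTensor.val_ext (opTensor_smul_left c A.val B.val))
    (fun A B B' => MinTensor.val_ext (opTensor_add_right A.val B.val B'.val))
    (fun c A B => MinTensor.val_ext (opTensor_smul_right c A.val B.val)))

theorem ofAlgTensor_tmul (A B : Toep) : ofAlgTensor (A ⊗ₜ B) = tmul A B := rfl

theorem exists_ofAlgTensor_mul (x y : Toep ⊗[ℂ] Toep) :
    ∃ z, (ofAlgTensor z).val =
      (ofAlgTensor x).val * (ofAlgTensor y).val := by
  induction x using TensorProduct.induction_on with
  | zero => exact ⟨0, by rw [map_zero, map_zero, zero_mul]⟩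
  | add a b ha hb =>
    obtain ⟨a', ha'⟩ := ha
    obtain ⟨b', hb'⟩ := hb
    exact ⟨a' + b', by
        rw [map_add, map_add, map_add, map_add, ha', hb']
        exact (ContinuousLinearMap.add_comp _ _ _).symm⟩
  | tmul A B =>
    induction y using TensorProduct.induction_on with
    | zero => exact ⟨0, by rw [map_zero, map_zero, mul_zero]⟩
    | add a b ha hb =>
      obtain ⟨a', ha'⟩ := ha
      obtain ⟨b', hb'⟩ := hb
      exact ⟨a' + b', by
        rw [map_add, map_add, map_add, map_add, ha', hb', mul_add]⟩
    | tmul C D => exact ⟨(A * C) ⊗ₜ (B * D), opTensor_mul _ _ _ _⟩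

theorem exists_ofAlgTensor_star (x : Toep ⊗[ℂ] Toep) :
    ∃ y, ofAlgTensor y = star (ofAlgTensor x) := by
  induction x using TensorProduct.induction_on with
  | zero => exact ⟨0, by simp⟩
  | add a b ha hb =>
    obtain ⟨a', ha'⟩ := ha
    obtain ⟨b', hb'⟩ := hb
    exact ⟨a' + b', by rw [map_add, map_add, ha', hb', star_add]⟩
  | tmul A B => exact ⟨star A ⊗ₜ star B, MinTensor.val_ext (opTensor_star _ _).symm⟩

theorem denseRange_ofAlgTensor : DenseRange ofAlgTensor := by
  have h : ∀ X ∈ StarAlgebra.adjoin ℂ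
      {X | ∃ A ∈ toeplitz, ∃ B ∈ toeplitz, X = opTensor A B},
      ∃ x, (ofAlgTensor x).val = X := by
    intro X hX
    induction hX using StarAlgebra.adjoin_induction with
    | mem X hX =>
      obtain ⟨A, hA, B, hB, rfl⟩ := hX
      exact ⟨(⟨A, hA⟩ : toeplitz) ⊗ₜ[ℂ] (⟨B, hB⟩ : toeplitz), rfl⟩
    | algebraMap c =>
      refine ⟨c • (1 ⊗ₜ 1), ?_⟩
      rw [map_smul, Algebra.algebraMap_eq_smul_one]
      exact congrArg (c • ·) opTensor_one
    | add X Y _ _ hX hY =>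
      obtain ⟨x, rfl⟩ := hX
      obtain ⟨y, rfl⟩ := hY
      exact ⟨x + y, by rw [map_add]; rfl⟩
    | mul X Y _ _ hX hY =>
      obtain ⟨x, rfl⟩ := hX
      obtain ⟨y, rfl⟩ := hY
      obtain ⟨z, hz⟩ := exists_ofAlgTensor_mul x y
      exact ⟨z, hz⟩
    | star X _ hX =>
      obtain ⟨x, rfl⟩ := hX
      obtain ⟨y, hy⟩ := exists_ofAlgTensor_star x
      exact ⟨y, by rw [hy]; rfl⟩
  intro X
  refine (closure_subtype (p := (· ∈ minTensor))).2 ?_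
  refine closure_mono ?_ X.2
  intro Y hY
  obtain ⟨x, rfl⟩ := h Y hY
  exact ⟨_, ⟨x, rfl⟩, rfl⟩

/-- The algebraic tensor product of two functionals. -/
def algFunctional (ρ φ : StrongDual ℂ Toep) : Toep ⊗[ℂ] Toep →ₗ[ℂ] ℂ :=
  LinearMap.mul' ℂ ℂ ∘ₗ TensorProduct.map (ρ : Toep →ₗ[ℂ] ℂ) (φ : Toep →ₗ[ℂ] ℂ)

/-- The functional `ω B = ⟪η, B ξ⟫`. -/
def vectorFunctional (ξ η : L2) : Toep →ₗ[ℂ] ℂ where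
  toFun B := inner ℂ η (B.val ξ)
  map_add' _ _ := inner_add_right _ _ _
  map_smul' _ _ := inner_smul_right _ _ _

/-- The slice map `ρ ⊗ id` on the algebraic tensor product. -/
def sliceLeft (ρ : Toep →ₗ[ℂ] ℂ) : Toep ⊗[ℂ] Toep →ₗ[ℂ] Toep :=
  (TensorProduct.lid ℂ Toep).toLinearMap ∘ₗ TensorProduct.map ρ LinearMap.id

/-- The slice map `id ⊗ ω` on the algebraic tensor product. -/
def sliceRight (ω : Toep →ₗ[ℂ] ℂ) : Toep ⊗[ℂ] Toep →ₗ[ℂ] Toep :=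
  (TensorProduct.rid ℂ Toep).toLinearMap ∘ₗ TensorProduct.map LinearMap.id ω

theorem coe_sliceRight (ξ η : L2) (x : Toep ⊗[ℂ] Toep) :
    (sliceRight (vectorFunctional ξ η) x).val =
      (vecL η).adjoint ∘L (ofAlgTensor x).val ∘L vecL ξ := by
  induction x using TensorProduct.induction_on with
  | zero => simp
  | add a b ha hb =>
    rw [map_add, map_add]
    simp only [map_add, ha, hb, ContinuousLinearMap.add_comp,
      ContinuousLinearMap.comp_add]
  | tmul A B =>
    refine ContinuousLinearMap.ext fun v => ext_inner_left ℂ fun u => ?_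
    have h1 : (sliceRight (vectorFunctional ξ η) (A ⊗ₜ B)).val v =
      inner ℂ η (B.val ξ) • A.val v := rfl
    have h2 : (ofAlgTensor (A ⊗ₜ B)).val = opTensor A.val B.val := rfl
    rw [h1, h2, ContinuousLinearMap.comp_apply, ContinuousLinearMap.adjoint_inner_right,
      ContinuousLinearMap.comp_apply, vecL_apply, vecL_apply, opTensor_vec, inner_vec,
      inner_smul_right, mul_comm]

theorem norm_sliceRight_le (ξ η : L2) (x : Toep ⊗[ℂ] Toep) :
    ‖sliceRight (vectorFunctional ξ η) x‖ ≤ ‖η‖ * ‖ξ‖ * ‖ofAlgTensor x‖ := by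
  have h : ‖(vecL η).adjoint‖ ≤ ‖η‖ := by
    rw [LinearIsometryEquiv.norm_map]
    exact norm_vecL_le η
  calc ‖sliceRight (vectorFunctional ξ η) x‖
      = ‖(vecL η).adjoint ∘L (ofAlgTensor x).val ∘L vecL ξ‖ := by
        rw [← coe_sliceRight]; rfl
    _ ≤ ‖(vecL η).adjoint‖ * (‖(ofAlgTensor x).val‖ * ‖vecL ξ‖) :=
        (ContinuousLinearMap.opNorm_comp_le _ _).trans (by
          gcongr
          exact ContinuousLinearMap.opNorm_comp_le _ _)
    _ ≤ ‖η‖ * (‖ofAlgTensor x‖ * ‖ξ‖) := by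
        gcongr
        · exact le_rfl
        · exact norm_vecL_le ξ
    _ = _ := by ring

theorem functional_sliceRight (ρ ω : Toep →ₗ[ℂ] ℂ) (x : Toep ⊗[ℂ] Toep) :
    ρ (sliceRight ω x) = ω (sliceLeft ρ x) := by
  induction x using TensorProduct.induction_on with
  | zero => simp
  | add a b ha hb => simp only [map_add, ha, hb]
  | tmul A B =>
    simp only [sliceRight, sliceLeft, LinearMap.comp_apply, TensorProduct.map_tmul,
      LinearMap.id_apply, LinearEquiv.coe_coe, TensorProduct.rid_tmul, TensorProduct.lid_tmul,
      map_smul, smul_eq_mul]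
    ring

theorem norm_sliceLeft_le (ρ : StrongDual ℂ Toep) (x : Toep ⊗[ℂ] Toep) :
    ‖sliceLeft (ρ : Toep →ₗ[ℂ] ℂ) x‖ ≤ ‖ρ‖ * ‖ofAlgTensor x‖ := by
  refine ContinuousLinearMap.opNorm_le_bound _ (by positivity) fun ξ => ?_
  generalize hD : (sliceLeft (ρ : Toep →ₗ[ℂ] ℂ) x).val = D
  change ‖(sliceLeft (ρ : Toep →ₗ[ℂ] ℂ) x).val ξ‖ ≤ _
  rw [hD]
  have h : ∀ η, ‖inner ℂ η (D ξ)‖ ≤ ‖ρ‖ * ‖ofAlgTensor x‖ * ‖ξ‖ * ‖η‖ := by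
    intro η
    rw [← hD]
    have h1 : inner ℂ η ((sliceLeft (ρ : Toep →ₗ[ℂ] ℂ) x).val ξ) = ρ (sliceRight (vectorFunctional ξ η) x) :=
      (functional_sliceRight (ρ : Toep →ₗ[ℂ] ℂ) (vectorFunctional ξ η) x).symm
    rw [h1]
    calc _ ≤ ‖ρ‖ * ‖sliceRight (vectorFunctional ξ η) x‖ := ρ.le_opNorm _
      _ ≤ ‖ρ‖ * (‖η‖ * ‖ξ‖ * ‖ofAlgTensor x‖) := by
        gcongr
        exact norm_sliceRight_le ξ η x
      _ = _ := by ring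
  have h2 := h (D ξ)
  rw [inner_self_eq_norm_sq_to_K] at h2
  rcases (norm_nonneg (D ξ)).eq_or_lt with h0 | h0
  · exact h0.symm.le.trans (by positivity)
  · refine le_of_mul_le_mul_right ?_ h0
    simpa [sq] using h2

theorem norm_algFunctional_le (ρ φ : StrongDual ℂ Toep) (x : Toep ⊗[ℂ] Toep) :
    ‖algFunctional ρ φ x‖ ≤ ‖ρ‖ * ‖φ‖ * ‖ofAlgTensor x‖ := by
  have h : algFunctional ρ φ x = φ (sliceLeft (ρ : Toep →ₗ[ℂ] ℂ) x) := by
    induction x using TensorProduct.induction_on with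
    | zero => simp
    | add a b ha hb => simp only [map_add, ha, hb]
    | tmul A B =>
      simp [sliceLeft, algFunctional]
  rw [h]
  calc _ ≤ ‖φ‖ * ‖sliceLeft (ρ : Toep →ₗ[ℂ] ℂ) x‖ := φ.le_opNorm _
    _ ≤ ‖φ‖ * (‖ρ‖ * ‖ofAlgTensor x‖) := by
      gcongr
      exact norm_sliceLeft_le ρ x
    _ = _ := by ring

/-- For two continuous functionals on the Toeplitz algebra there is exactly one continuous
functional on the minimal tensor product that maps `A ⊗ B` to `ρ A * φ B`. -/
theorem existsUnique_tensorFunctional (ρ φ : StrongDual ℂ Toep) :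
    ∃! F : StrongDual ℂ MinTensor, ∀ A B, F (tmul A B) = ρ A * φ B := by
  refine ⟨(algFunctional ρ φ).extendOfNorm ofAlgTensor, fun A B => ?_, fun F hF => ?_⟩
  · rw [← ofAlgTensor_tmul, LinearMap.extendOfNorm_eq denseRange_ofAlgTensor
      ⟨_, norm_algFunctional_le ρ φ⟩]
    rfl
  · refine (LinearMap.extendOfNorm_unique denseRange_ofAlgTensor _
      (norm_algFunctional_le ρ φ) F ?_).symm
    exact TensorProduct.ext' hF

/-- The functional `ρ ⊗ φ` on the minimal tensor product: the unique continuous functional with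
`(ρ ⊗ φ) (A ⊗ B) = ρ A * φ B`. -/
def tensorFunctional (ρ φ : StrongDual ℂ Toep) : StrongDual ℂ MinTensor :=
  Classical.choose (existsUnique_tensorFunctional ρ φ)

theorem tensorFunctional_tmul (ρ φ : StrongDual ℂ Toep) (A B : Toep) :
    tensorFunctional ρ φ (tmul A B) = ρ A * φ B :=
  (Classical.choose_spec (existsUnique_tensorFunctional ρ φ)).1 A B

/-- The product on the dual space: `(ρ ∗ φ) A = (ρ ⊗ φ) (Δ A)`. -/
def convolution (ρ φ : StrongDual ℂ Toep) : StrongDual ℂ Toep where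
  toFun A := tensorFunctional ρ φ (comul A)
  map_add' A B := by rw [map_add, map_add]
  map_smul' c A := by rw [map_smul, map_smul]; rfl
  cont := (tensorFunctional ρ φ).continuous.comp continuous_comul

end Toeplitz

/-- The operation `m` makes the complex normed space `E` a commutative Banach algebra, which need
not have a unit: `E` is complete, and `m` is bilinear, associative, commutative and
submultiplicative for the norm. -/
structure IsCommBanachAlgebra (E : Type*) [NormedAddCommGroup E] [NormedSpace ℂ E]
    (m : E → E → E) : Prop where
  complete : CompleteSpace E
  add_left : ∀ x y z, m (x + y) z = m x z + m y z
  add_right : ∀ x y z, m x (y + z) = m x y + m x z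
  smul_left : ∀ (c : ℂ) x y, m (c • x) y = c • m x y
  smul_right : ∀ (c : ℂ) x y, m x (c • y) = c • m x y
  assoc : ∀ x y z, m (m x y) z = m x (m y z)
  comm : ∀ x y, m x y = m y x
  norm_le : ∀ x y, ‖m x y‖ ≤ ‖x‖ * ‖y‖

end

namespace Toeplitz

/-! Call `A` group-like if `Δ A = A ⊗ A`. Since `Δ` is a unital star homomorphism, the group-like
elements contain 1 and are closed under products and adjoints. They contain `T`, hence every word in
`T` and `T*`, and these words span a dense subspace of the Toeplitz algebra. A continuous functional
is therefore determined by its values on group-like elements (`functional_ext`), and there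
convolution is the pointwise product of values (`convolution_groupLike`). Every algebraic law,
associativity included, thus reduces to the same law in `ℂ`; neither coassociativity of `Δ` nor a
triple tensor product is needed. The norm inequality combines `‖ρ ⊗ φ‖ ≤ ‖ρ‖ ‖φ‖`, which comes from
the slice map estimates, with the contractivity of `Δ`. Completeness holds for the dual of any
normed space. -/

theorem tmul_mul_tmul (A B C D : Toep) : tmul A B * tmul C D = tmul (A * C) (B * D) :=
  MinTensor.val_ext (opTensor_mul A.val B.val C.val D.val).symm

theorem star_tmul (A B : Toep) : star (tmul A B) = tmul (star A) (star B) :=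
  MinTensor.val_ext (opTensor_star A.val B.val)

theorem tmul_one_one : tmul 1 1 = 1 :=
  MinTensor.val_ext opTensor_one

/-- The submonoid of group-like elements of the Toeplitz algebra, those with `Δ A = A ⊗ A`. -/
def groupLike : Submonoid Toep where
  carrier := {A | comul A = tmul A A}
  one_mem' := by
    change comul 1 = tmul 1 1
    rw [map_one, tmul_one_one]
  mul_mem' {A B} hA hB := by
    change comul A = tmul A A at hA
    change comul B = tmul B B at hB
    change comul (A * B) = tmul (A * B) (A * B)
    rw [map_mul, hA, hB, tmul_mul_tmul]

theorem mem_groupLike {A : Toep} : A ∈ groupLike ↔ comul A = tmul A A := Iff.rfl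

theorem T_mem_groupLike : T ∈ groupLike := comul_T

theorem star_mem_groupLike {A : Toep} (hA : A ∈ groupLike) : star A ∈ groupLike := by
  rw [mem_groupLike] at hA ⊢
  rw [map_star, hA, star_tmul]

/-- The star algebra generated by `shift` is the linear span of the words in `shift` and its
adjoint, and each such word lifts to a group-like element. -/
theorem exists_mem_span_groupLike {X : L2 →L[ℂ] L2} (hX : X ∈ StarAlgebra.adjoin ℂ {shift}) :
    ∃ A ∈ Submodule.span ℂ (groupLike : Set Toep), A.val = X := by
  have h : Submonoid.closure ({shift} ∪ star {shift}) ≤ groupLike.map Toep.val := by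
    rw [Submonoid.closure_le]
    rintro Y (rfl | hY)
    · exact ⟨T, T_mem_groupLike, rfl⟩
    -- Membership of `Y` in `star {shift}` unfolds to `star Y = shift`.
    · obtain rfl : Y = star shift := star_eq_iff_star_eq.1 (Set.mem_singleton_iff.1 hY) |>.symm
      exact ⟨star T, star_mem_groupLike T_mem_groupLike, rfl⟩
  have hspan : X ∈ Submodule.span ℂ
      (Submonoid.closure ({shift} ∪ star {shift}) : Set (L2 →L[ℂ] L2)) := by
    rw [← StarAlgebra.adjoin_eq_span]
    exact hX
  have hle := Submodule.span_mono (R := ℂ) (SetLike.coe_subset_coe.2 h) hspan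
  rw [Submonoid.coe_map] at hle
  exact (Submodule.map_span (Toep.val : Toep →ₗ[ℂ] (L2 →L[ℂ] L2)) _).ge hle

/-- The group-like elements span a dense subspace of the Toeplitz algebra. -/
theorem dense_span_groupLike : Dense (Submodule.span ℂ (groupLike : Set Toep) : Set Toep) := by
  intro A
  -- The norm of `Toep` is the operator norm, so closures may be taken in the ambient algebra, where
  -- `A.2` places `A` in the closure of the generated star algebra.
  refine (closure_subtype (p := (· ∈ toeplitz))).2 ?_
  refine closure_mono ?_ A.2
  intro X hX
  obtain ⟨B, hB, rfl⟩ := exists_mem_span_groupLike hX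
  exact ⟨B, hB, rfl⟩

/-! ### Functionals and their convolution on group-like elements -/

theorem functional_ext {ρ φ : StrongDual ℂ Toep} (h : ∀ A ∈ groupLike, ρ A = φ A) : ρ = φ :=
  ContinuousLinearMap.ext_on dense_span_groupLike h

theorem convolution_apply (ρ φ : StrongDual ℂ Toep) (A : Toep) :
    convolution ρ φ A = tensorFunctional ρ φ (comul A) := rfl

theorem convolution_groupLike (ρ φ : StrongDual ℂ Toep) {A : Toep} (hA : A ∈ groupLike) :
    convolution ρ φ A = ρ A * φ A := by
  rw [convolution_apply, mem_groupLike.1 hA, tensorFunctional_tmul]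

/-! ### Norm estimates -/

/-- The functional is specified only by its values on elementary tensors. By linearity these fix it
on the algebraic tensor product, where `norm_algFunctional_le` applies; the bound is a closed
condition, so it passes to the closure. -/
theorem norm_tensorFunctional_apply_le (ρ φ : StrongDual ℂ Toep) (X : MinTensor) :
    ‖tensorFunctional ρ φ X‖ ≤ ‖ρ‖ * ‖φ‖ * ‖X‖ := by
  have h : ∀ x, tensorFunctional ρ φ (ofAlgTensor x) = algFunctional ρ φ x := by
    intro x
    induction x using TensorProduct.induction_on with
    | zero => simp only [map_zero]
    | add a b ha hb => simp only [map_add, ha, hb]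
    | tmul A B =>
      rw [ofAlgTensor_tmul, tensorFunctional_tmul]
      rfl
  refine denseRange_ofAlgTensor.induction_on X
    (isClosed_le (tensorFunctional ρ φ).continuous.norm (continuous_const.mul continuous_norm))
    fun x => ?_
  rw [h]
  exact norm_algFunctional_le ρ φ x

theorem norm_convolution_le (ρ φ : StrongDual ℂ Toep) : ‖convolution ρ φ‖ ≤ ‖ρ‖ * ‖φ‖ := by
  refine ContinuousLinearMap.opNorm_le_bound _ (by positivity) fun A => ?_
  refine (norm_tensorFunctional_apply_le ρ φ (comul A)).trans ?_
  gcongr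
  -- Star homomorphisms between C*-algebras are contractive.
  exact NonUnitalStarAlgHom.norm_apply_le comul A

end Toeplitz

theorem theorem7 :
    IsCommBanachAlgebra (StrongDual ℂ Toeplitz.Toep) Toeplitz.convolution := by
  refine ⟨inferInstance, fun x y z => ?_, fun x y z => ?_, fun c x y => ?_, fun c x y => ?_,
    fun x y z => ?_, fun x y => ?_, Toeplitz.norm_convolution_le⟩ <;>
  -- The six algebraic laws remain. At a group-like `A` every convolution, nested ones too, becomes
  -- a product of complex numbers.
  refine Toeplitz.functional_ext fun A hA => ?_ <;>
  simp only [Toeplitz.convolution_groupLike _ _ hA, add_apply, smul_apply, smul_eq_mul] <;>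
  ring
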